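/- Let $a_1,\dots,a_n\in\mathbb{C}$, $n\ge 0$, be distinct points, let $X=\mathbb{C}\setminus\{a_1,\dots,a_n\}$ and $\mathbb{C}^*=\mathbb{C}\setminus\{0\}$. Say that a map $\psi$ on $X$ identifies the pair $(x,y)\in X\times X$ of distinct points if $\psi(x)=\psi(y)$. Then: (1) The null homotopy class of continuous maps $X\to\mathbb{C}\times\mathbb{C}^*$ contains a proper holomorphic immersion that identifies at most countably many pairs of distinct points of $X$. More precisely, for every $c\in X$ the map $$\psi(z)=\Bigl(\frac{(z-c)^{n+1}}{(z-a_1)\cdots(z-a_n)},\,e^z\Bigr)$$ is such an immersion. (2) Every non-null homotopy class of continuous maps $X\to\mathbb{C}\times\mathbb{C}^*$ contains a proper holomorphic immersion that identifies at most finitely many pairs of distinct points of $X$. More precisely, it contains one of the form $$\psi(z)=\Bigl(\frac{p(z)}{q(z)},\,\prod_{j=1}^n (z-a_j)^{k_j}\Bigr),$$ where $k_1,\dots,k_n$ are integers, $q(z)=\prod_{j:\,k_j=0}(z-a_j)$, and $p$ is a complex polynomial with $\deg p>\deg q$ that has no common zero with $q$. -/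

import Mathlib

open Polynomial
open scoped Manifold

/-- The finitely punctured plane `ℂ ∖ {a₁, …, aₙ}`, as an open subset of `ℂ`
(hence a Riemann surface). -/
def puncturedPlane {n : ℕ} (a : Fin n → ℂ) : TopologicalSpace.Opens ℂ :=
  ⟨(Set.range a)ᶜ, (Set.finite_range a).isClosed.isOpen_compl⟩

/-- A holomorphic immersion of an open subset `U` of `ℂ` into the complex manifold `ℂ × ℂˣ`:
a map that is complex differentiable on `U` and whose differential is injective at every point. -/
def IsHolomorphicImmersion {U : TopologicalSpace.Opens ℂ} (ψ : U → ℂ × ℂˣ) : Prop :=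
  MDifferentiable 𝓘(ℂ) (𝓘(ℂ).prod 𝓘(ℂ)) ψ ∧
    ∀ z : U, Function.Injective (mfderiv 𝓘(ℂ) (𝓘(ℂ).prod 𝓘(ℂ)) ψ z)

/-- The set of (ordered) pairs of distinct points that are identified by `ψ`. -/
def identifiedPairs {X Y : Type*} (ψ : X → Y) : Set (X × X) :=
  {xy | xy.1 ≠ xy.2 ∧ ψ xy.1 = ψ xy.2}

/-! Since `ℂ` is contractible, only the second component matters up to homotopy, and only modulo
exponentials. A nonvanishing continuous function on `X` is `e^L ∏ (z - a j)^(k j)`, so a non-null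
class has `k ≠ 0`.

Properness is checked at the ends. At infinity `p/q` blows up because `deg p > deg q`. At a puncture
either `p/q` has a pole or the second component tends to `0` or `∞`.

In the null class `e^z` is already immersive, and points it identifies differ by `2πim`. Each `m ≠
0` leaves a nonzero polynomial equation, hence countably many pairs.

Otherwise the second component is `P/Q` with nonzero Wronskian, so it has finitely many critical
points, and its double points form a curve `F(x,y) = 0`. A generic `p` makes `p/q` immersive at
those critical points and separates the points of one fibre of the curve. A resultant then leaves
finitely many double points (`exists_generic_numerator`). -/

/-! ### Continuous logarithms on the punctured plane -/

theorem exists_continuous_exp_eq {g : ℂ → ℂ} (hg : Continuous g) (h0 : ∀ z, g z ≠ 0) :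
    ∃ L : ℂ → ℂ, Continuous L ∧ ∀ z, Complex.exp (L z) = g z := by
  obtain ⟨f, ⟨-, hf⟩, -⟩ := Complex.isCoveringMapOn_exp.existsUnique_continuousMap_lifts
    ⟨g, hg⟩ (Complex.exp_log (h0 0)) h0
  exact ⟨f, f.continuous, fun z ↦ congrFun hf z⟩

/-- A `2πi`-periodic continuous function of `log z` is continuous on `ℂ ∖ {0}`. -/
theorem continuousOn_comp_log {N : ℂ → ℂ} (hN : Continuous N)
    (hper : ∀ w, N (w + 2 * Real.pi * Complex.I) = N w) :
    ContinuousOn (fun z ↦ N (Complex.log z)) {0}ᶜ := by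
  have hp : Function.Periodic N (2 * Real.pi * Complex.I) := hper
  intro z hz
  apply ContinuousAt.continuousWithinAt
  by_cases hs : z ∈ Complex.slitPlane
  · exact hN.continuousAt.comp (continuousAt_clog hs)
  -- Across the cut, `log(-z) + πi` is a continuous branch; by periodicity `N` does not see which
  -- branch is used.
  · have hneg : -z ∈ Complex.slitPlane :=
      (Complex.mem_slitPlane_or_neg_mem_slitPlane hz).resolve_left hs
    have hc : ContinuousAt (fun z ↦ N (Complex.log (-z) + Real.pi * Complex.I)) z :=
      hN.continuousAt.comp (((continuousAt_clog hneg).comp continuousAt_neg).add continuousAt_const)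
    refine hc.congr ?_
    filter_upwards [isOpen_compl_singleton.mem_nhds hz] with w hw
    have hw' : w ≠ 0 := hw
    have he : Complex.exp (Complex.log (-w) + Real.pi * Complex.I) =
        Complex.exp (Complex.log w) := by
      rw [Complex.exp_add, Complex.exp_log (neg_ne_zero.2 hw'), Complex.exp_pi_mul_I,
        Complex.exp_log hw']
      ring
    obtain ⟨m, hm⟩ := Complex.exp_eq_exp_iff_exists_int.1 he
    rw [hm]
    exact (hp.int_mul m) _

/-- Near an isolated puncture, a nonvanishing continuous function is a power times an exponential
of a function which is continuous away from the puncture. -/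
theorem exists_log_near_puncture {g : ℂ → ℂ} {a : ℂ} {r : ℝ} (hr : 0 < r)
    (hg : ContinuousOn g (Metric.ball a r \ {a})) (h0 : ∀ z ∈ Metric.ball a r \ {a}, g z ≠ 0) :
    ∃ (k : ℤ) (L : ℂ → ℂ) (s : ℝ), 0 < s ∧ ContinuousOn L {a}ᶜ ∧
      ∀ z ∈ Metric.ball a s \ {a}, g z = Complex.exp (L z) * (z - a) ^ k := by
  -- Exponential coordinate at `a`, with the real part capped so that it is defined on all of `ℂ`
  -- and stays in the punctured ball.
  set ρ : ℂ → ℂ := fun w ↦ a + Complex.exp ((min w.re (Real.log (r / 2)) : ℝ) + w.im * Complex.I)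
    with hρ
  have hρc : Continuous ρ := by
    rw [hρ]
    fun_prop
  have hρmem : ∀ w, ρ w ∈ Metric.ball a r \ {a} := by
    intro w
    refine ⟨?_, ?_⟩
    · have : Real.exp (min w.re (Real.log (r / 2))) ≤ r / 2 := by
        calc _ ≤ Real.exp (Real.log (r / 2)) := Real.exp_le_exp.2 (min_le_right _ _)
          _ = r / 2 := Real.exp_log (by positivity)
      simp only [hρ, Metric.mem_ball, dist_eq_norm, add_sub_cancel_left, Complex.norm_exp]
      simp at this ⊢
      linarith
    · simp [hρ]
  obtain ⟨M, hM, hMe⟩ := exists_continuous_exp_eq (g := fun w ↦ g (ρ w))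
    (hg.comp_continuous hρc hρmem) (fun w ↦ h0 _ (hρmem w))
  have hρper : ∀ w, ρ (w + 2 * Real.pi * Complex.I) = ρ w := by
    intro w
    simp only [hρ]
    congr 1
    rw [Complex.exp_eq_exp_iff_exists_int]
    refine ⟨1, ?_⟩
    simp
    ring
  have hpi : (2 * Real.pi * Complex.I : ℂ) ≠ 0 := Complex.two_pi_I_ne_zero
  -- The increment of the logarithm `M` over one period is `2πi` times a continuous integer: the
  -- winding number `k`. Subtracting `k * w` makes `M` periodic.
  have hint : ∀ w, ∃ m : ℤ, M (w + 2 * Real.pi * Complex.I) - M w = m * (2 * Real.pi * Complex.I) := by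
    intro w
    have : Complex.exp (M (w + 2 * Real.pi * Complex.I)) = Complex.exp (M w) := by
      rw [hMe, hMe, hρper]
    obtain ⟨m, hm⟩ := Complex.exp_eq_exp_iff_exists_int.1 this
    exact ⟨m, by rw [hm]; ring⟩
  choose m hm using hint
  have hmc : Continuous m := by
    have : (fun n : ℤ ↦ (n : ℂ)) ∘ m =
        fun w ↦ (M (w + 2 * Real.pi * Complex.I) - M w) / (2 * Real.pi * Complex.I) := by
      ext w
      simp only [Function.comp_apply]
      rw [hm, mul_div_cancel_right₀ _ hpi]
    rw [Complex.isClosedEmbedding_intCast.isInducing.continuous_iff, this]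
    fun_prop
  have hmconst : ∀ w, m w = m 0 := fun w ↦
    PreconnectedSpace.constant inferInstance hmc
  set k := m 0
  set N : ℂ → ℂ := fun w ↦ M w - k * w with hNdef
  have hNc : Continuous N := by fun_prop
  have hNper : ∀ w, N (w + 2 * Real.pi * Complex.I) = N w := by
    intro w
    have := hm w
    rw [hmconst w] at this
    simp only [hNdef]
    linear_combination this
  refine ⟨k, fun z ↦ N (Complex.log (z - a)), r / 2, by positivity, ?_, ?_⟩
  · exact (continuousOn_comp_log hNc hNper).comp (by fun_prop)
      (fun z hz ↦ by simpa [sub_eq_zero] using hz)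
  · rintro z ⟨hz, hza⟩
    have hza' : z - a ≠ 0 := sub_ne_zero.2 hza
    have hn : ‖z - a‖ < r / 2 := by simpa [dist_eq_norm] using hz
    have hρz : ρ (Complex.log (z - a)) = z := by
      simp only [hρ]
      rw [min_eq_left, Complex.re_add_im, Complex.exp_log hza']
      · ring
      · rw [Complex.log_re]
        exact Real.log_le_log (norm_pos_iff.2 hza') hn.le
    simp only [hNdef]
    rw [Complex.exp_sub, hMe, hρz, Complex.exp_int_mul, Complex.exp_log hza',
      div_mul_cancel₀]
    exact zpow_ne_zero _ hza'

/-- A nonvanishing continuous function on the complement of a finite set is a product of integer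
powers of the linear factors and an exponential. -/
theorem exists_eq_exp_mul_prod_zpow (A : Finset ℂ) : ∀ g : ℂ → ℂ, ContinuousOn g (A : Set ℂ)ᶜ →
    (∀ z ∉ A, g z ≠ 0) → ∃ (k : ℂ → ℤ) (L : ℂ → ℂ), ContinuousOn L (A : Set ℂ)ᶜ ∧
      ∀ z ∉ A, g z = Complex.exp (L z) * ∏ a ∈ A, (z - a) ^ k a := by
  classical
  induction A using Finset.induction_on with
  | empty =>
    intro g hg h0
    obtain ⟨L, hL, hLe⟩ := exists_continuous_exp_eq (by simpa [continuousOn_univ] using hg)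
      (fun z ↦ h0 z (by simp))
    exact ⟨0, L, hL.continuousOn, by simp [hLe]⟩
  | insert a A haA ih =>
    intro g hg h0
    obtain ⟨r, hr, hrA⟩ : ∃ r > 0, Metric.ball a r ⊆ (A : Set ℂ)ᶜ :=
      Metric.isOpen_iff.1 A.finite_toSet.isClosed.isOpen_compl a (by simpa using haA)
    have hsub : Metric.ball a r \ {a} ⊆ ((insert a A : Finset ℂ) : Set ℂ)ᶜ := by
      rintro z ⟨hz, hza⟩
      have := hrA hz
      simp_all
    obtain ⟨k, L, s, hs, hL, hLe⟩ := exists_log_near_puncture hr (hg.mono hsub)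
      (fun z hz ↦ h0 z (by simpa using hsub hz))
    -- Dividing by the local form at `a` gives a function equal to `1` near `a`, which extends
    -- across the puncture, so induction applies.
    set g₁ : ℂ → ℂ := fun z ↦ g z * (z - a) ^ (-k) * Complex.exp (-L z) with hg₁
    have hg₁one : ∀ z ∈ Metric.ball a s \ {a}, g₁ z = 1 := by
      intro z hz
      have : (z - a) ≠ 0 := sub_ne_zero.2 hz.2
      simp only [hg₁]
      rw [hLe z hz, Complex.exp_neg, zpow_neg]
      field_simp [Complex.exp_ne_zero, zpow_ne_zero]
    have hg₁c : ContinuousOn g₁ ((insert a A : Finset ℂ) : Set ℂ)ᶜ := by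
      refine (hg.mul ?_).mul (Complex.continuous_exp.comp_continuousOn (hL.mono ?_).neg)
      · refine ContinuousOn.zpow₀ (by fun_prop) _ fun z hz ↦ Or.inl (sub_ne_zero.2 ?_)
        rintro rfl
        simp at hz
      · intro z hz
        simp at hz
        simpa using hz.1
    have hgpc : ContinuousOn (Function.update g₁ a 1) (A : Set ℂ)ᶜ := by
      intro z hz
      apply ContinuousAt.continuousWithinAt
      by_cases hza : z = a
      · subst hza
        refine (continuousAt_const (y := (1 : ℂ))).congr ?_
        filter_upwards [Metric.ball_mem_nhds z hs] with w hw
        by_cases hwz : w = z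
        · simp [hwz]
        · rw [Function.update_of_ne hwz, hg₁one w ⟨hw, hwz⟩]
      · rw [continuousAt_update_of_ne hza]
        refine hg₁c.continuousAt ((Finset.finite_toSet _).isClosed.isOpen_compl.mem_nhds ?_)
        simp_all
    obtain ⟨k', L', hL', hLe'⟩ := ih _ hgpc (fun z hz ↦ by
      by_cases hza : z = a
      · simp [hza]
      · rw [Function.update_of_ne hza]
        exact mul_ne_zero (mul_ne_zero (h0 z (by simp [hz, hza]))
          (zpow_ne_zero _ (sub_ne_zero.2 hza))) (Complex.exp_ne_zero _))
    refine ⟨Function.update k' a k, fun z ↦ L' z + L z, (hL'.mono ?_).add (hL.mono ?_), ?_⟩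
    · intro z hz
      simp at hz
      simpa using hz.2
    · intro z hz
      simp at hz
      simpa using hz.1
    · intro z hz
      simp only [Finset.mem_insert, not_or] at hz
      have hza : z - a ≠ 0 := sub_ne_zero.2 hz.1
      have h1 := hLe' z hz.2
      rw [Function.update_of_ne hz.1] at h1
      have hprod : ∏ b ∈ A, (z - b) ^ Function.update k' a k b = ∏ b ∈ A, (z - b) ^ k' b :=
        Finset.prod_congr rfl fun b hb ↦ by
          rw [Function.update_of_ne (by rintro rfl; exact haA hb)]
      rw [Finset.prod_insert haA, Function.update_self, hprod, Complex.exp_add]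
      calc g z = g₁ z * (Complex.exp (L z) * (z - a) ^ k) := by
            simp only [hg₁]
            rw [Complex.exp_neg, zpow_neg]
            field_simp [Complex.exp_ne_zero, zpow_ne_zero]
        _ = _ := by rw [h1]; ring

/-! ### Properness -/

/-- In the variable `1/u`, with coefficients reversed at `N = natDegree p`, the limit of the
equation reads `leadingCoeff p = y * 0`. -/
theorem not_tendsto_of_eval_eq_mul_of_cocompact {p q : ℂ[X]} (hpq : q.degree < p.degree)
    {α : Type*} {l : Filter α} [l.NeBot] {u f : α → ℂ} (hu : Filter.Tendsto u l (Filter.cocompact ℂ))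
    (h : ∀ x, p.eval (u x) = f x * q.eval (u x)) (y : ℂ) : ¬ Filter.Tendsto f l (nhds y) := by
  intro hf
  have hinv : Filter.Tendsto (fun x ↦ (u x)⁻¹) l (nhds 0) :=
    (Filter.tendsto_inv₀_cobounded (α := ℂ)).comp (Metric.cobounded_eq_cocompact (α := ℂ) ▸ hu)
  have hne : ∀ᶠ x in l, u x ≠ 0 := by
    have := hu.eventually (isCompact_singleton (x := (0 : ℂ))).compl_mem_cocompact
    exact this
  have hp0 : p ≠ 0 := by
    rintro rfl
    simp at hpq
  set N := p.natDegree
  have hqN : q.natDegree ≤ N := natDegree_le_natDegree hpq.le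
  have key : ∀ᶠ x in l, (reflect N p).eval (u x)⁻¹ = f x * (reflect N q).eval (u x)⁻¹ := by
    filter_upwards [hne] with x hx
    let _ : Invertible (u x) := invertibleOfNonzero hx
    have e1 := eval₂_reflect_mul_pow (RingHom.id ℂ) (u x) N p le_rfl
    have e2 := eval₂_reflect_mul_pow (RingHom.id ℂ) (u x) N q hqN
    simp only [invOf_eq_inv, eval₂_id] at e1 e2
    have := h x
    rw [← e1, ← e2] at this
    apply mul_right_cancel₀ (pow_ne_zero N hx)
    rw [this]
    ring
  have l1 : Filter.Tendsto (fun x ↦ (reflect N p).eval (u x)⁻¹) l (nhds ((reflect N p).eval 0)) :=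
    ((reflect N p).continuous.tendsto 0).comp hinv
  have l2 : Filter.Tendsto (fun x ↦ (reflect N q).eval (u x)⁻¹) l (nhds ((reflect N q).eval 0)) :=
    ((reflect N q).continuous.tendsto 0).comp hinv
  have := tendsto_nhds_unique (l1.congr' key) (hf.mul l2)
  rw [← coeff_zero_eq_eval_zero, ← coeff_zero_eq_eval_zero, coeff_reflect, coeff_reflect] at this
  simp only [revAt_zero] at this
  rw [coeff_eq_zero_of_degree_lt (p := q) (by rwa [← degree_eq_natDegree hp0])] at this
  simp [N, hp0] at this

theorem Ultrafilter.le_cocompact_or_exists_le_nhds (𝒰 : Ultrafilter ℂ) :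
    (𝒰 : Filter ℂ) ≤ Filter.cocompact ℂ ∨ ∃ z, (𝒰 : Filter ℂ) ≤ nhds z := by
  by_cases h : (𝒰 : Filter ℂ) ≤ Filter.cocompact ℂ
  · exact Or.inl h
  · right
    rw [← Ultrafilter.disjoint_iff_not_le, Filter.disjoint_cocompact_right] at h
    obtain ⟨K, hKU, hK⟩ := h
    obtain ⟨z, -, hz⟩ := hK.ultrafilter_le_nhds 𝒰 (Filter.le_principal_iff.2 hKU)
    exact ⟨z, hz⟩

/-- An ultrafilter on `X` with convergent image must converge in `X`: the degrees exclude escape to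
infinity, and `ha` excludes each puncture. -/
theorem isProperMap_of_eval_eq_mul {n : ℕ} {a : Fin n → ℂ} {Y : Type*} [TopologicalSpace Y]
    [T2Space Y] {ψ : puncturedPlane a → ℂ × Y} (hψ : Continuous ψ) {p q : ℂ[X]}
    (hpq : q.degree < p.degree)
    (h : ∀ z : puncturedPlane a, p.eval (z : ℂ) = (ψ z).1 * q.eval (z : ℂ))
    (ha : ∀ j, (p.eval (a j) ≠ 0 ∧ q.eval (a j) = 0) ∨
      ∀ (l : Filter (puncturedPlane a)) [l.NeBot] (y : Y),
        Filter.Tendsto (fun z : puncturedPlane a ↦ (z : ℂ)) l (nhds (a j)) →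
          ¬ Filter.Tendsto (fun z ↦ (ψ z).2) l (nhds y)) : IsProperMap ψ := by
  rw [isProperMap_iff_ultrafilter_of_t2]
  refine ⟨hψ, fun 𝒰 y hy ↦ ?_⟩
  have h1 : Filter.Tendsto (fun z ↦ (ψ z).1) 𝒰 (nhds y.1) := (continuous_fst.tendsto y).comp hy
  have h2 : Filter.Tendsto (fun z ↦ (ψ z).2) 𝒰 (nhds y.2) := (continuous_snd.tendsto y).comp hy
  rcases (𝒰.map Subtype.val).le_cocompact_or_exists_le_nhds with hc | ⟨z, hz⟩
  · exact absurd h1 (not_tendsto_of_eval_eq_mul_of_cocompact hpq hc h _)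
  · by_cases hza : z ∈ puncturedPlane a
    · exact ⟨⟨z, hza⟩, by rwa [nhds_subtype_eq_comap, ← Filter.map_le_iff_le_comap]⟩
    · obtain ⟨j, rfl⟩ : z ∈ Set.range a := not_not.1 hza
      have hz' : Filter.Tendsto (fun z : puncturedPlane a ↦ (z : ℂ)) 𝒰 (nhds (a j)) := hz
      rcases ha j with ⟨hp, hq⟩ | hj
      · have l1 := (p.continuous.tendsto (a j)).comp hz'
        have l2 := h1.mul ((q.continuous.tendsto (a j)).comp hz')
        refine absurd (tendsto_nhds_unique (l1.congr fun z ↦ h z) l2) ?_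
        rwa [hq, mul_zero]
      · exact absurd h2 (hj _ _ hz')

/-! ### Elimination and the generic numerator -/

/-- The resultant in `y` is a combination of `F` and `G`, so it vanishes below common zeros. At `x₀`
it is a power of the leading coefficient of `F` times the product of the values of `G` on the fibre,
hence nonzero. -/
theorem exists_ne_zero_of_no_common_zero_on_fiber {K : Type*} [Field K] [IsAlgClosed K]
    (F G : K[X][X]) (x₀ : K) (hlc : F.leadingCoeff.eval x₀ ≠ 0)
    (h : ∀ y, F.evalEval x₀ y = 0 → G.evalEval x₀ y ≠ 0) :
    ∃ r : K[X], r ≠ 0 ∧ ∀ x y, F.evalEval x y = 0 → G.evalEval x y = 0 → r.eval x = 0 := by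
  -- The formal degree of `G` is raised by one so that it is positive; this costs only a factor that
  -- is nonzero at `x₀`.
  obtain ⟨A, B, -, -, hAB⟩ := exists_mul_add_mul_eq_C_resultant (m := F.natDegree)
    (n := G.natDegree + 1) F G le_rfl (Nat.le_succ _) (Or.inr (Nat.succ_ne_zero _))
  refine ⟨F.resultant G F.natDegree (G.natDegree + 1), ?_, fun x y hF hG ↦ ?_⟩
  rotate_left
  · have := congrArg (evalEval x y) hAB
    rw [evalEval_add, evalEval_mul, evalEval_mul, hF, hG, evalEval_C] at this
    rw [← this]
    ring
  · intro h0
    have h1 := resultant_map_map F G F.natDegree (G.natDegree + 1) (evalRingHom x₀)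
    have hd : (F.map (evalRingHom x₀)).natDegree = F.natDegree :=
      natDegree_map_of_leadingCoeff_ne_zero _ hlc
    have hF0 : F.map (evalRingHom x₀) ≠ 0 := by
      intro h
      have := coeff_map (evalRingHom x₀) F.natDegree (p := F)
      rw [h, coeff_zero] at this
      exact hlc this.symm
    rw [h0, map_zero, ← hd, resultant_eq_prod_eval _ _ _
      (natDegree_map_le.trans (Nat.le_succ _)) (IsAlgClosed.splits _), mul_eq_zero] at h1
    rcases h1 with h1 | h1
    · exact hF0 (leadingCoeff_eq_zero.1 (pow_eq_zero_iff (Nat.succ_ne_zero _) |>.1 h1))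
    · rw [Multiset.prod_eq_zero_iff, Multiset.mem_map] at h1
      obtain ⟨y, hy, hy0⟩ := h1
      rw [mem_roots hF0, IsRoot, map_evalRingHom_eval] at hy
      rw [map_evalRingHom_eval] at hy0
      exact h y hy hy0

/-- The divided difference of the bivariate polynomial `P(x) Q(y) - Q(x) P(y)`. -/
theorem exists_dividedDifference {R : Type*} [CommRing R] (P Q : R[X]) :
    ∃ F : R[X][X], (∀ x y, (y - x) * F.evalEval x y = P.eval x * Q.eval y - Q.eval x * P.eval y) ∧
      ∀ x, F.evalEval x x = (wronskian P Q).eval x := by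
  set H : R[X][X] := C P * Q.map C - C Q * P.map C with hH
  have hroot : H.IsRoot X := by
    simp only [IsRoot, hH, eval_sub, eval_mul, eval_C, eval_map, eval₂_C_X]
    ring
  obtain ⟨F, hF⟩ := dvd_iff_isRoot.2 hroot
  have hmap : ∀ (T : R[X]) (x y : R), (T.map C).evalEval x y = T.eval y := by
    intro T x y
    simp [evalEval, eval_map, eval₂_at_apply]
  refine ⟨F, fun x y ↦ ?_, fun x ↦ ?_⟩
  · have := congrArg (evalEval x y) hF
    simp only [hH, evalEval_sub, evalEval_mul, hmap, evalEval_C, evalEval_X, eval_X] at this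
    exact this.symm
  -- Differentiating `H = (y - x) F` in `y` and restricting to the diagonal leaves `F`.
  · have := congrArg (fun T ↦ evalEval x x (derivative T)) hF
    simp only [hH, derivative_sub, derivative_mul, derivative_C, derivative_X, derivative_map,
      evalEval_sub, evalEval_add, evalEval_mul, hmap, evalEval_C, evalEval_X, eval_X] at this
    simp [wronskian] at this ⊢
    linear_combination -this

/-- Each demand on `p` is the nonvanishing of a nonzero linear functional. Finitely many such
demands can be met at once, since finitely many proper subspaces do not cover a complex vector
space. -/
theorem exists_generic_numerator (P Q q : ℂ[X]) (hW : wronskian P Q ≠ 0) (hq : q ≠ 0) :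
    ∃ p : ℂ[X], q.degree < p.degree ∧ (∀ z, q.eval z = 0 → p.eval z ≠ 0) ∧
      (∀ z, (wronskian P Q).eval z = 0 → q.eval z ≠ 0 →
        (derivative p * q - p * derivative q).eval z ≠ 0) ∧
      {xy : ℂ × ℂ | xy.1 ≠ xy.2 ∧ P.eval xy.1 * Q.eval xy.2 = Q.eval xy.1 * P.eval xy.2 ∧
        p.eval xy.1 * q.eval xy.2 = q.eval xy.1 * p.eval xy.2}.Finite := by
  obtain ⟨F, hF, hFd⟩ := exists_dividedDifference P Q
  have hF0 : F ≠ 0 := by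
    rintro rfl
    refine hW (Polynomial.funext fun x ↦ ?_)
    rw [← hFd x]
    simp
  -- The Wronskian is `F` on the diagonal, so at `x₀` the fibre of `F` is finite and avoids `y =
  -- x₀`.
  obtain ⟨x₀, hx₀⟩ : ∃ x, (F.leadingCoeff * wronskian P Q * q).eval x ≠ 0 := by
    by_contra! h
    exact mul_ne_zero (mul_ne_zero (leadingCoeff_ne_zero.2 hF0) hW) hq
      (Polynomial.funext fun x ↦ by rw [h x, eval_zero])
  simp only [eval_mul, mul_ne_zero_iff] at hx₀
  obtain ⟨⟨hlc, hW₀⟩, hq₀⟩ := hx₀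
  have hFx₀ : F.map (evalRingHom x₀) ≠ 0 := by
    intro h
    have := hFd x₀
    rw [← map_evalRingHom_eval, h, eval_zero] at this
    exact hW₀ this.symm
  -- In order: the degree of `p`, no common zero with `q`, `(p/q)' ≠ 0` at critical points of `P/Q`,
  -- and separation of `x₀` from its fibre.
  let S : Set (Module.Dual ℂ ℂ[X]) := {lcoeff ℂ (q.natDegree + 1)} ∪
    ((fun z ↦ leval z) '' (q.rootSet ℂ) ∪
    ((fun z ↦ q.eval z • leval z ∘ₗ derivative - (derivative q).eval z • leval z) ''
      ((wronskian P Q).rootSet ℂ \ q.rootSet ℂ) ∪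
    (fun y ↦ q.eval y • leval x₀ - q.eval x₀ • leval y) ''
      ((F.map (evalRingHom x₀)).rootSet ℂ)))
  have hS : S.Finite := (Set.finite_singleton _).union (((rootSet_finite _ _).image _).union
    ((((rootSet_finite _ _).sdiff).image _).union ((rootSet_finite _ _).image _)))
  have : Finite S := hS
  obtain ⟨p, hp⟩ := Module.Dual.exists_forall_ne_zero_of_forall_exists (fun f : S ↦ f.1) (by
    rintro ⟨f, rfl | ⟨z, hz, rfl⟩ | ⟨z, ⟨hz, hzq⟩, rfl⟩ | ⟨y, hy, rfl⟩⟩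
    · exact ⟨X ^ (q.natDegree + 1), by simp⟩
    · exact ⟨1, by simp⟩
    · refine ⟨X - C z, ?_⟩
      simpa [mem_rootSet, hq] using hzq
    · refine ⟨X - C x₀, ?_⟩
      have hy' : F.evalEval x₀ y = 0 := by
        rw [← map_evalRingHom_eval]
        simpa using (mem_rootSet.1 hy).2
      have : y ≠ x₀ := by
        rintro rfl
        exact hW₀ (by rw [← hFd, hy'])
      simp [hq₀, sub_eq_zero, this])
  have hpS : ∀ f ∈ S, f p ≠ 0 := fun f hf ↦ hp ⟨f, hf⟩
  refine ⟨p, ?_, ?_, ?_, ?_⟩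
  · have := hpS _ (Or.inl rfl)
    have h1 := le_degree_of_ne_zero this
    refine lt_of_lt_of_le ?_ h1
    rw [degree_eq_natDegree hq]
    exact_mod_cast Nat.lt_succ_self _
  · intro z hz
    exact hpS _ (Or.inr (Or.inl ⟨z, by simp [mem_rootSet, hq, hz], rfl⟩))
  · intro z hz hqz
    have := hpS _ (Or.inr (Or.inr (Or.inl ⟨z, ⟨by simp [mem_rootSet, hW, hz],
      by simp [mem_rootSet, hq, hqz]⟩, rfl⟩)))
    simp at this ⊢
    exact fun h0 ↦ this (by linear_combination h0)
  · obtain ⟨r, hr, hrz⟩ := exists_ne_zero_of_no_common_zero_on_fiber F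
      (C p * q.map C - C q * p.map C) x₀ hlc (fun y hy ↦ by
        have := hpS _ (Or.inr (Or.inr (Or.inr ⟨y, by
          rw [mem_rootSet]
          exact ⟨hFx₀, by simpa [map_evalRingHom_eval] using hy⟩, rfl⟩)))
        simp [evalEval, eval_map, eval₂_at_apply] at this ⊢
        exact fun h0 ↦ this (by linear_combination h0))
    -- The equations are symmetric in `x` and `y`, so bounding `x` also bounds `y`.
    have hzero : ∀ x y, x ≠ y → P.eval x * Q.eval y = Q.eval x * P.eval y →
        p.eval x * q.eval y = q.eval x * p.eval y → x ∈ r.rootSet ℂ := by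
      intro x y hxy h1 h2
      rw [mem_rootSet]
      refine ⟨hr, ?_⟩
      rw [coe_aeval_eq_eval]
      refine hrz x y ?_ ?_
      · have := hF x y
        rw [h1, sub_self, mul_eq_zero, sub_eq_zero] at this
        exact this.resolve_left hxy.symm
      · simp [evalEval, eval_map, eval₂_at_apply, h2]
    refine ((rootSet_finite r ℂ).prod (rootSet_finite r ℂ)).subset ?_
    rintro ⟨x, y⟩ ⟨hxy, h1, h2⟩
    exact ⟨hzero x y hxy h1 h2, hzero y x hxy.symm (by linear_combination -h1)
      (by linear_combination -h2)⟩

/-! ### Homotopies -/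

/-- The exponential as a map to the units of `ℂ`. -/
noncomputable def expUnit (w : ℂ) : ℂˣ := Units.mk0 (Complex.exp w) (Complex.exp_ne_zero w)

@[simp]
theorem val_expUnit (w : ℂ) : (expUnit w : ℂ) = Complex.exp w := rfl

theorem continuous_expUnit : Continuous expUnit := by
  rw [Units.continuous_iff]
  refine ⟨Complex.continuous_exp, ?_⟩
  have : (fun w ↦ ((expUnit w)⁻¹ : ℂˣ).val) = fun w ↦ Complex.exp (-w) := by
    ext w
    simp [Complex.exp_neg]
  rw [this]
  fun_prop

theorem homotopic_of_snd_eq_exp_mul {X : Type*} [TopologicalSpace X] (f g : C(X, ℂ × ℂˣ))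
    (L : C(X, ℂ)) (h : ∀ x, ((f x).2 : ℂ) = Complex.exp (L x) * (g x).2) : f.Homotopic g := by
  refine ⟨⟨⟨fun tx ↦ ((1 - (tx.1 : ℝ) : ℂ) * (f tx.2).1 + (tx.1 : ℝ) * (g tx.2).1,
    expUnit ((1 - (tx.1 : ℝ) : ℂ) * L tx.2) * (g tx.2).2), ?_⟩, ?_, ?_⟩⟩
  · refine Continuous.prodMk (by fun_prop) (Continuous.mul (continuous_expUnit.comp ?_) ?_) <;>
      fun_prop
  · intro x
    refine Prod.ext (by simp) (Units.ext ?_)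
    simp [h]
  · intro x
    refine Prod.ext (by simp) (Units.ext ?_)
    simp

/-! ### Immersions -/

theorem mfderiv_subtype_val_injective {U : TopologicalSpace.Opens ℂ} (z : U) :
    Function.Injective (mfderiv 𝓘(ℂ) 𝓘(ℂ) (Subtype.val : U → ℂ) z) := by
  classical
  set s : ℂ → U := fun w ↦ if h : w ∈ U then ⟨w, h⟩ else z with hs
  have hsval : s ∘ Subtype.val = (id : U → U) := by
    ext w
    simp [hs]
  have hsm : MDifferentiableAt 𝓘(ℂ) 𝓘(ℂ) s (z : ℂ) := by
    have : ContMDiffAt 𝓘(ℂ) 𝓘(ℂ) 1 s (z : ℂ) := by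
      rw [← contMDiffAt_subtype_iff]
      change ContMDiffAt 𝓘(ℂ) 𝓘(ℂ) 1 (s ∘ Subtype.val) z
      rw [hsval]
      exact contMDiffAt_id
    exact this.mdifferentiableAt one_ne_zero
  have hv : MDifferentiableAt 𝓘(ℂ) 𝓘(ℂ) (Subtype.val : U → ℂ) z :=
    (contMDiff_subtype_val (n := 1) z).mdifferentiableAt one_ne_zero
  have hcomp := mfderiv_comp z hsm hv
  rw [hsval, mfderiv_id] at hcomp
  refine Function.LeftInverse.injective (g := mfderiv 𝓘(ℂ) 𝓘(ℂ) s (z : ℂ)) fun v ↦ ?_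
  exact (congrArg (fun T ↦ T v) hcomp).symm

/-- By the chain rule, the differential of `ψ` followed by that of a coordinate projection is
injective as soon as that coordinate has nonzero derivative. -/
theorem isHolomorphicImmersion_of_deriv_ne_zero {U : TopologicalSpace.Opens ℂ} {ψ : U → ℂ × ℂˣ}
    {f g : ℂ → ℂ} (hf : ∀ z : U, (ψ z).1 = f z) (hg : ∀ z : U, ((ψ z).2 : ℂ) = g z)
    (hfd : DifferentiableOn ℂ f U) (hgd : DifferentiableOn ℂ g U)
    (hne : ∀ z : U, deriv f z ≠ 0 ∨ deriv g z ≠ 0) : IsHolomorphicImmersion ψ := by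
  have key : ∀ {f : ℂ → ℂ}, DifferentiableOn ℂ f U →
      ContMDiff 𝓘(ℂ) 𝓘(ℂ) 1 (fun z : U ↦ f z) := fun {f} hf z ↦ by
    rw [contMDiffAt_subtype_iff, contMDiffAt_iff_contDiffAt]
    exact (hf.contDiffOn U.isOpen).contDiffAt (U.isOpen.mem_nhds z.2)
  have h1 : ContMDiff 𝓘(ℂ) 𝓘(ℂ) 1 (fun z ↦ (ψ z).1) := by
    simpa only [hf] using key hfd
  have h2 : ContMDiff 𝓘(ℂ) 𝓘(ℂ) 1 (fun z ↦ (ψ z).2) := by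
    refine ContMDiff.of_comp_isOpenEmbedding (e' := (Units.val : ℂˣ → ℂ))
      Units.isOpenEmbedding_val ?_
    have : (Units.val : ℂˣ → ℂ) ∘ (fun z ↦ (ψ z).2) = fun z : U ↦ g z := funext hg
    rw [this]
    exact key hgd
  have hψ : MDifferentiable 𝓘(ℂ) (𝓘(ℂ).prod 𝓘(ℂ)) ψ :=
    (h1.prodMk h2).mdifferentiable one_ne_zero
  have inj : ∀ {π : ℂ × ℂˣ → ℂ} {f : ℂ → ℂ} (z : U), ContMDiff (𝓘(ℂ).prod 𝓘(ℂ)) 𝓘(ℂ) 1 π →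
      (∀ z : U, π (ψ z) = f z) → DifferentiableOn ℂ f U → deriv f z ≠ 0 →
      Function.Injective (mfderiv 𝓘(ℂ) (𝓘(ℂ).prod 𝓘(ℂ)) ψ z) := by
    intro π f z hπ hπf hfd hz
    have hfz : DifferentiableAt ℂ f z := hfd.differentiableAt (U.isOpen.mem_nhds z.2)
    have hv : MDifferentiableAt 𝓘(ℂ) 𝓘(ℂ) (Subtype.val : U → ℂ) z :=
      (contMDiff_subtype_val (n := 1) z).mdifferentiableAt one_ne_zero
    have e : π ∘ ψ = f ∘ Subtype.val := funext hπf
    have c1 := mfderiv_comp z ((hπ (ψ z)).mdifferentiableAt one_ne_zero) (hψ z)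
    have c2 := mfderiv_comp z hfz.mdifferentiableAt hv
    rw [e, c2] at c1
    have hinj : Function.Injective (mfderiv 𝓘(ℂ) 𝓘(ℂ) f (z : ℂ)) := by
      have hinj' : Function.Injective (fderiv ℂ f (z : ℂ)) := by
        intro v w hvw
        rw [fderiv_eq_smul_deriv, fderiv_eq_smul_deriv] at hvw
        exact mul_right_cancel₀ hz hvw
      rw [mfderiv_eq_fderiv]
      exact hinj'
    intro v w hvw
    apply mfderiv_subtype_val_injective z
    apply hinj
    have h1 := congrArg (fun T ↦ T v) c1
    have h2 := congrArg (fun T ↦ T w) c1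
    refine h1.trans (Eq.trans ?_ h2.symm)
    exact congrArg (mfderiv (𝓘(ℂ).prod 𝓘(ℂ)) 𝓘(ℂ) π (ψ z)) hvw
  refine ⟨hψ, fun z ↦ ?_⟩
  rcases hne z with hz | hz
  · exact inj z contMDiff_fst hf hfd hz
  · exact inj z (Units.contMDiff_val.comp contMDiff_snd) hg hgd hz

/-! ### Rational functions on the punctured plane -/

theorem mem_puncturedPlane {n : ℕ} {a : Fin n → ℂ} {z : ℂ} :
    z ∈ puncturedPlane a ↔ ∀ j, z ≠ a j := by
  change z ∉ Set.range a ↔ _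
  simp [eq_comm]

theorem sub_ne_zero_of_mem_puncturedPlane {n : ℕ} {a : Fin n → ℂ} (z : puncturedPlane a)
    (j : Fin n) : (z : ℂ) - a j ≠ 0 :=
  sub_ne_zero.2 (mem_puncturedPlane.1 z.2 j)

theorem exists_continuousMap_prod_units {X : Type*} [TopologicalSpace X] {f g : X → ℂ}
    (hf : Continuous f) (hg : Continuous g) (h0 : ∀ z, g z ≠ 0) :
    ∃ ψ : C(X, ℂ × ℂˣ), ∀ z, (ψ z).1 = f z ∧ ((ψ z).2 : ℂ) = g z :=
  ⟨⟨fun z ↦ (f z, Units.mk0 (g z) (h0 z)),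
    hf.prodMk (Units.isOpenEmbedding_val.isInducing.continuous_iff.2 hg)⟩, fun _ ↦ ⟨rfl, rfl⟩⟩

theorem deriv_eval_div_eval {p q : ℂ[X]} {z : ℂ} (hz : q.eval z ≠ 0) :
    deriv (fun z ↦ p.eval z / q.eval z) z =
      (derivative p * q - p * derivative q).eval z / q.eval z ^ 2 := by
  rw [deriv_fun_div p.differentiableAt q.differentiableAt hz]
  simp

theorem differentiableOn_eval_div_eval (p : ℂ[X]) {q : ℂ[X]} {s : Set ℂ}
    (hs : ∀ z ∈ s, q.eval z ≠ 0) : DifferentiableOn ℂ (fun z ↦ p.eval z / q.eval z) s :=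
  p.differentiable.differentiableOn.div q.differentiable.differentiableOn hs

theorem eval_prod_X_sub_C_ne_zero {n : ℕ} {a : Fin n → ℂ} (s : Finset (Fin n))
    (z : puncturedPlane a) : (∏ j ∈ s, (X - C (a j))).eval (z : ℂ) ≠ 0 := by
  rw [eval_prod, Finset.prod_ne_zero_iff]
  intro j _
  simpa using sub_ne_zero_of_mem_puncturedPlane z j

/-- The polynomial `∏ j, (z - a j) ^ max (k j) 0`. -/
noncomputable def posPartPoly {n : ℕ} (a : Fin n → ℂ) (k : Fin n → ℤ) : ℂ[X] :=
  ∏ j, (X - C (a j)) ^ (k j).toNat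

theorem eval_posPartPoly {n : ℕ} (a : Fin n → ℂ) (k : Fin n → ℤ) (z : ℂ) :
    (posPartPoly a k).eval z = ∏ j, (z - a j) ^ (k j).toNat := by
  simp [posPartPoly, eval_prod]

theorem eval_posPartPoly_eq_zero_iff {n : ℕ} {a : Fin n → ℂ} (ha : Function.Injective a)
    (k : Fin n → ℤ) (j : Fin n) : (posPartPoly a k).eval (a j) = 0 ↔ 0 < k j := by
  rw [eval_posPartPoly, Finset.prod_eq_zero_iff]
  constructor
  · rintro ⟨i, -, hi⟩
    obtain ⟨h1, h2⟩ := pow_eq_zero_iff'.1 hi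
    rw [ha (sub_eq_zero.1 h1)]
    omega
  · intro h
    refine ⟨j, Finset.mem_univ _, ?_⟩
    rw [sub_self, zero_pow]
    omega

theorem eval_posPartPoly_ne_zero {n : ℕ} {a : Fin n → ℂ} (k : Fin n → ℤ) (z : puncturedPlane a) :
    (posPartPoly a k).eval (z : ℂ) ≠ 0 := by
  rw [eval_posPartPoly, Finset.prod_ne_zero_iff]
  exact fun j _ ↦ pow_ne_zero _ (sub_ne_zero_of_mem_puncturedPlane z j)

theorem prod_zpow_mul_eval_posPartPoly_neg {n : ℕ} {a : Fin n → ℂ} (k : Fin n → ℤ)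
    (z : puncturedPlane a) :
    (∏ j, ((z : ℂ) - a j) ^ k j) * (posPartPoly a (-k)).eval (z : ℂ) = (posPartPoly a k).eval (z : ℂ) := by
  rw [eval_posPartPoly, eval_posPartPoly, ← Finset.prod_mul_distrib]
  refine Finset.prod_congr rfl fun j _ ↦ ?_
  rw [← zpow_natCast, ← zpow_natCast, ← zpow_add₀ (sub_ne_zero_of_mem_puncturedPlane z j)]
  congr 1
  simp only [Pi.neg_apply]
  omega

theorem isCoprime_posPartPoly_posPartPoly_neg {n : ℕ} {a : Fin n → ℂ} (ha : Function.Injective a)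
    (k : Fin n → ℤ) : IsCoprime (posPartPoly a k) (posPartPoly a (-k)) := by
  refine IsCoprime.prod_left fun i _ ↦ IsCoprime.prod_right fun j _ ↦ ?_
  by_cases hij : i = j
  · subst hij
    rcases le_total (k i) 0 with h | h
    · rw [Int.toNat_of_nonpos h, pow_zero]
      exact isCoprime_one_left
    · rw [Int.toNat_of_nonpos (z := (-k) i) (by simpa using h), pow_zero]
      exact isCoprime_one_right
  · exact (isCoprime_X_sub_C_of_isUnit_sub (sub_ne_zero.2 (ha.ne hij)).isUnit).pow

theorem monic_posPartPoly {n : ℕ} (a : Fin n → ℂ) (k : Fin n → ℤ) : (posPartPoly a k).Monic :=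
  monic_prod_of_monic _ _ fun _ _ ↦ (monic_X_sub_C _).pow _

theorem derivative_posPartPoly_ne_zero {n : ℕ} {a : Fin n → ℂ} (ha : Function.Injective a)
    {k : Fin n → ℤ} {j : Fin n} (hj : 0 < k j) : derivative (posPartPoly a k) ≠ 0 := by
  intro h
  have h1 := (monic_posPartPoly a k).natDegree_eq_zero.1 (derivative_eq_zero.1 h)
  have := (eval_posPartPoly_eq_zero_iff ha k j).2 hj
  simp [h1] at this

/-- The Wronskian of coprime polynomials vanishes only if both derivatives do, whereas `k ≠ 0` makes
one of the two nonconstant. -/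
theorem wronskian_posPartPoly_ne_zero {n : ℕ} {a : Fin n → ℂ} (ha : Function.Injective a)
    {k : Fin n → ℤ} (hk : k ≠ 0) : wronskian (posPartPoly a k) (posPartPoly a (-k)) ≠ 0 := by
  rw [Ne, (isCoprime_posPartPoly_posPartPoly_neg ha k).wronskian_eq_zero_iff]
  rintro ⟨h1, h2⟩
  obtain ⟨j, hj⟩ := Function.ne_iff.1 hk
  rcases lt_or_gt_of_ne hj with hj | hj
  · exact derivative_posPartPoly_ne_zero ha (j := j) (by simpa using hj) h2
  · exact derivative_posPartPoly_ne_zero ha hj h1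

/-- Every map from the punctured plane to `ℂˣ` is a product of integer powers of the `z - a j`
up to the exponential of a continuous function. -/
theorem exists_snd_eq_exp_mul_prod_zpow {n : ℕ} {a : Fin n → ℂ} (ha : Function.Injective a)
    (h : C(puncturedPlane a, ℂ × ℂˣ)) :
    ∃ (k : Fin n → ℤ) (L : C(puncturedPlane a, ℂ)), ∀ z : puncturedPlane a,
      ((h z).2 : ℂ) = Complex.exp (L z) * ∏ j, ((z : ℂ) - a j) ^ k j := by
  classical
  set g : ℂ → ℂ := fun z ↦ if hz : z ∈ puncturedPlane a then ((h ⟨z, hz⟩).2 : ℂ) else 1 with hg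
  have hgz : ∀ z : puncturedPlane a, g z = (h z).2 := fun z ↦ by simp [hg]
  have hA : ((Finset.univ.image a : Finset ℂ) : Set ℂ)ᶜ = puncturedPlane a := by
    simp [puncturedPlane]
  have hgc : ContinuousOn g (puncturedPlane a) := by
    rw [continuousOn_iff_continuous_domRestrict]
    have : (puncturedPlane a : Set ℂ).domRestrict g = fun z : puncturedPlane a ↦ ((h z).2 : ℂ) :=
      funext hgz
    rw [this]
    exact Units.continuous_val.comp (continuous_snd.comp h.continuous)
  obtain ⟨k, L, hL, hLe⟩ := exists_eq_exp_mul_prod_zpow (Finset.univ.image a) g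
    (by rwa [hA]) (fun z _ ↦ by
      by_cases hz : z ∈ puncturedPlane a <;> simp [hg, hz])
  rw [hA] at hL
  refine ⟨k ∘ a, ⟨fun z ↦ L z, continuousOn_iff_continuous_domRestrict.1 hL⟩, fun z ↦ ?_⟩
  have hz : (z : ℂ) ∉ Finset.univ.image a := by
    simpa [eq_comm] using mem_puncturedPlane.1 z.2
  rw [← hgz, hLe z hz, Finset.prod_image ha.injOn]
  rfl

/-! ### The null homotopy class -/

/-- An identified pair is `(x, x + 2πim)` with `m ≠ 0` and `x` a root of `T m`. This polynomial is
nonzero at `c`, the only zero of `p`. -/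
theorem countable_identifiedPairs_eval_div_exp {U : Set ℂ} {Y : Type*} {ψ : U → Y} {p q : ℂ[X]}
    (hq : ∀ z ∈ U, q.eval z ≠ 0) {c : ℂ} (hc : c ∈ U) (hp : ∀ z, p.eval z = 0 ↔ z = c)
    (hψ : ∀ x y : U, ψ x = ψ y → p.eval (x : ℂ) / q.eval (x : ℂ) = p.eval (y : ℂ) / q.eval (y : ℂ) ∧
      Complex.exp x = Complex.exp y) : (identifiedPairs ψ).Countable := by
  set t : ℤ → ℂ := fun m ↦ m * (2 * Real.pi * Complex.I) with ht
  set T : ℤ → ℂ[X] := fun m ↦ p * q.comp (X + C (t m)) - p.comp (X + C (t m)) * q with hT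
  have hT0 : ∀ m, m ≠ 0 → T m ≠ 0 := by
    intro m hm h0
    have h1 := congrArg (eval c) h0
    simp only [hT, eval_sub, eval_mul, eval_comp, eval_add, eval_X, eval_C, (hp c).2 rfl,
      zero_mul, zero_sub, eval_zero, neg_eq_zero, mul_eq_zero, hq c hc, or_false, hp] at h1
    have h2 : t m ≠ 0 := mul_ne_zero (Int.cast_ne_zero.2 hm) Complex.two_pi_I_ne_zero
    exact h2 (by simpa using h1)
  have hcount : (⋃ m : ℤ, (fun x ↦ (x, x + t m)) '' ((T m).rootSet ℂ)).Countable :=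
    Set.countable_iUnion fun m ↦ ((rootSet_finite _ _).countable).image _
  refine (hcount.preimage_of_injOn (f := fun xy : U × U ↦ ((xy.1 : ℂ), (xy.2 : ℂ))) ?_).mono ?_
  · exact (Subtype.val_injective.prodMap Subtype.val_injective).injOn
  · rintro ⟨x, y⟩ ⟨hne, hxy⟩
    obtain ⟨h1, h2⟩ := hψ x y hxy
    obtain ⟨m, hm⟩ := Complex.exp_eq_exp_iff_exists_int.1 h2.symm
    have hm0 : m ≠ 0 := by
      rintro rfl
      exact hne (Subtype.ext (by simpa using hm.symm))
    refine Set.mem_iUnion.2 ⟨m, (x : ℂ), ?_, Prod.ext rfl hm.symm⟩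
    rw [mem_rootSet]
    refine ⟨hT0 m hm0, ?_⟩
    rw [div_eq_div_iff (hq _ x.2) (hq _ y.2)] at h1
    simp only [hT, coe_aeval_eq_eval, eval_sub, eval_mul, eval_comp, eval_add, eval_X, eval_C,
      ht, ← hm, h1, sub_self]

theorem exists_properImmersion_of_nullhomotopic {n : ℕ} {a : Fin n → ℂ}
    {h : C(puncturedPlane a, ℂ × ℂˣ)} (hh : h.Nullhomotopic) (c : puncturedPlane a) :
    ∃ ψ : C(puncturedPlane a, ℂ × ℂˣ),
      h.Homotopic ψ ∧ IsProperMap ψ ∧ IsHolomorphicImmersion ψ ∧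
      (identifiedPairs ψ).Countable ∧
      ∀ z : puncturedPlane a,
        (ψ z).1 = ((z : ℂ) - c) ^ (n + 1) / ∏ j, ((z : ℂ) - a j) ∧
        ((ψ z).2 : ℂ) = Complex.exp z := by
  set p : ℂ[X] := (X - C (c : ℂ)) ^ (n + 1) with hp
  set q : ℂ[X] := ∏ j, (X - C (a j)) with hq
  have hq0 : ∀ z ∈ puncturedPlane a, q.eval z ≠ 0 := fun z hz ↦
    eval_prod_X_sub_C_ne_zero Finset.univ ⟨z, hz⟩
  have hpz : ∀ z, p.eval z = 0 ↔ z = c := fun z ↦ by simp [hp, sub_eq_zero]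
  have hfd := differentiableOn_eval_div_eval p (s := puncturedPlane a) hq0
  obtain ⟨ψ, hψ⟩ := exists_continuousMap_prod_units
    (continuousOn_iff_continuous_domRestrict.1 hfd.continuousOn)
    (Complex.continuous_exp.comp continuous_subtype_val)
    (fun z : puncturedPlane a ↦ Complex.exp_ne_zero z)
  have hψ1 : ∀ z : puncturedPlane a, (ψ z).1 = p.eval (z : ℂ) / q.eval (z : ℂ) := fun z ↦ (hψ z).1
  have hψ2 : ∀ z : puncturedPlane a, ((ψ z).2 : ℂ) = Complex.exp z := fun z ↦ (hψ z).2
  refine ⟨ψ, ?_, ?_, ?_, ?_, fun z ↦ ⟨?_, hψ2 z⟩⟩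
  · obtain ⟨y, hy⟩ := hh
    -- The constant `y.2` is `e^(log y.2 - z) * e^z`.
    refine hy.trans (homotopic_of_snd_eq_exp_mul _ _
      ⟨fun z ↦ Complex.log (y.2 : ℂ) - z, by fun_prop⟩ fun z ↦ ?_)
    simp [hψ2, Complex.exp_sub, Complex.exp_log, Complex.exp_ne_zero]
  · refine isProperMap_of_eval_eq_mul ψ.continuous (p := p) (q := q) ?_ ?_ fun j ↦ Or.inl ⟨?_, ?_⟩
    · rw [degree_eq_natDegree (monic_prod_X_sub_C _ _).ne_zero,
        degree_eq_natDegree ((monic_X_sub_C _).pow _).ne_zero, natDegree_finsetProd_X_sub_C_eq_card,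
        natDegree_pow, natDegree_X_sub_C]
      simp
      exact_mod_cast Nat.lt_succ_self n
    · intro z
      rw [hψ1, div_mul_cancel₀ _ (hq0 z z.2)]
    · rw [Ne, hpz]
      exact (mem_puncturedPlane.1 c.2 j).symm
    · simp only [hq, eval_prod]
      exact Finset.prod_eq_zero (Finset.mem_univ j) (by simp)
  · refine isHolomorphicImmersion_of_deriv_ne_zero hψ1 hψ2 hfd
      Complex.differentiable_exp.differentiableOn fun z ↦ Or.inr ?_
    simp
  · refine countable_identifiedPairs_eval_div_exp (U := puncturedPlane a) hq0 c.2 hpz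
      fun x y hxy ↦ ⟨?_, ?_⟩
    · rw [← hψ1, ← hψ1, hxy]
    · rw [← hψ2, ← hψ2, hxy]
  · rw [hψ1]
    simp [hp, hq, eval_prod]

/-! ### The non-null homotopy classes -/

/-- If `k j ≠ 0`, exactly one of the two polynomials in `h2` vanishes at `a j`, so the second
component has no limit in `ℂˣ` there. -/
theorem isProperMap_of_eval_eq_mul_of_eval_posPartPoly {n : ℕ} {a : Fin n → ℂ}
    (ha : Function.Injective a) {ψ : puncturedPlane a → ℂ × ℂˣ} (hψ : Continuous ψ)
    {k : Fin n → ℤ} {p q : ℂ[X]} (hpq : q.degree < p.degree)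
    (h1 : ∀ z : puncturedPlane a, p.eval (z : ℂ) = (ψ z).1 * q.eval (z : ℂ))
    (h2 : ∀ z : puncturedPlane a, (posPartPoly a k).eval (z : ℂ) =
      (ψ z).2 * (posPartPoly a (-k)).eval (z : ℂ))
    (hk : ∀ j, k j = 0 → p.eval (a j) ≠ 0 ∧ q.eval (a j) = 0) : IsProperMap ψ := by
  refine isProperMap_of_eval_eq_mul hψ hpq h1 fun j ↦ ?_
  by_cases hj : k j = 0
  · exact Or.inl (hk j hj)
  · refine Or.inr fun l _ y hl hy ↦ ?_
    have l1 := ((posPartPoly a k).continuous.tendsto (a j)).comp hl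
    have l2 := ((Units.continuous_val.tendsto y).comp hy).mul
      (((posPartPoly a (-k)).continuous.tendsto (a j)).comp hl)
    have e := tendsto_nhds_unique (l1.congr fun z ↦ h2 z) l2
    have z1 := eval_posPartPoly_eq_zero_iff ha k j
    have z2 := eval_posPartPoly_eq_zero_iff ha (-k) j
    rw [e, mul_eq_zero, or_iff_right y.ne_zero, z2, Pi.neg_apply] at z1
    omega

theorem exists_properImmersion_of_not_nullhomotopic {n : ℕ} {a : Fin n → ℂ}
    (ha : Function.Injective a) {h : C(puncturedPlane a, ℂ × ℂˣ)} (hh : ¬ h.Nullhomotopic) :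
    ∃ ψ : C(puncturedPlane a, ℂ × ℂˣ),
      h.Homotopic ψ ∧ IsProperMap ψ ∧ IsHolomorphicImmersion ψ ∧
      (identifiedPairs ψ).Finite ∧
      ∃ (k : Fin n → ℤ) (p q : ℂ[X]),
        q = ∏ j with k j = 0, (X - C (a j)) ∧ q.degree < p.degree ∧ IsCoprime p q ∧
        ∀ z : puncturedPlane a,
          (ψ z).1 = p.eval (z : ℂ) / q.eval (z : ℂ) ∧
          ((ψ z).2 : ℂ) = ∏ j, ((z : ℂ) - a j) ^ k j := by
  obtain ⟨k, L, hL⟩ := exists_snd_eq_exp_mul_prod_zpow ha h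
  have hk : k ≠ 0 := by
    rintro rfl
    exact hh ⟨(0, 1), homotopic_of_snd_eq_exp_mul _ _ L fun z ↦ by simp [hL]⟩
  set P := posPartPoly a k
  set Q := posPartPoly a (-k)
  set q : ℂ[X] := ∏ j with k j = 0, (X - C (a j)) with hq
  have hq0 : ∀ z ∈ puncturedPlane a, q.eval z ≠ 0 := fun z hz ↦
    eval_prod_X_sub_C_ne_zero _ ⟨z, hz⟩
  have hQ0 : ∀ z ∈ puncturedPlane a, Q.eval z ≠ 0 := fun z hz ↦ eval_posPartPoly_ne_zero (-k) ⟨z, hz⟩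
  have hP0 : ∀ z ∈ puncturedPlane a, P.eval z ≠ 0 := fun z hz ↦ eval_posPartPoly_ne_zero k ⟨z, hz⟩
  obtain ⟨p, hdeg, hpq, himm, hfin⟩ := exists_generic_numerator P Q q
    (wronskian_posPartPoly_ne_zero ha hk) (monic_prod_of_monic _ _ fun _ _ ↦ monic_X_sub_C _).ne_zero
  have hfd := differentiableOn_eval_div_eval p hq0
  have hgd := differentiableOn_eval_div_eval P hQ0
  obtain ⟨ψ, hψ⟩ := exists_continuousMap_prod_units
    (continuousOn_iff_continuous_domRestrict.1 hfd.continuousOn)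
    (continuousOn_iff_continuous_domRestrict.1 hgd.continuousOn)
    (fun z : puncturedPlane a ↦ div_ne_zero (hP0 z z.2) (hQ0 z z.2))
  have hψ1 : ∀ z : puncturedPlane a, (ψ z).1 = p.eval (z : ℂ) / q.eval (z : ℂ) := fun z ↦ (hψ z).1
  have hψ2 : ∀ z : puncturedPlane a, ((ψ z).2 : ℂ) = P.eval (z : ℂ) / Q.eval (z : ℂ) :=
    fun z ↦ (hψ z).2
  have hψ3 : ∀ z : puncturedPlane a, ((ψ z).2 : ℂ) = ∏ j, ((z : ℂ) - a j) ^ k j := fun z ↦ by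
    rw [hψ2, div_eq_iff (hQ0 z z.2), prod_zpow_mul_eval_posPartPoly_neg]
  refine ⟨ψ, ?_, ?_, ?_, ?_, k, p, q, hq, hdeg, ?_, fun z ↦ ⟨hψ1 z, hψ3 z⟩⟩
  · exact homotopic_of_snd_eq_exp_mul _ _ L fun z ↦ by rw [hL, hψ3]
  · refine isProperMap_of_eval_eq_mul_of_eval_posPartPoly ha ψ.continuous (k := k) hdeg ?_ ?_ ?_
    · intro z
      rw [hψ1, div_mul_cancel₀ _ (hq0 z z.2)]
    · intro z
      rw [hψ2, div_mul_cancel₀ _ (hQ0 z z.2)]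
    · intro j hj
      have hqj : q.eval (a j) = 0 := by
        simp only [hq, eval_prod]
        exact Finset.prod_eq_zero (i := j) (by simp [hj]) (by simp)
      exact ⟨hpq _ hqj, hqj⟩
  · refine isHolomorphicImmersion_of_deriv_ne_zero hψ1 hψ2 hfd hgd fun z ↦ ?_
    rw [deriv_eval_div_eval (hq0 z z.2), deriv_eval_div_eval (hQ0 z z.2)]
    -- Where the second component is critical, the choice of `p` makes the first one regular.
    by_cases hz : (wronskian P Q).eval (z : ℂ) = 0
    · exact Or.inl (div_ne_zero (himm z hz (hq0 z z.2)) (pow_ne_zero _ (hq0 z z.2)))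
    · refine Or.inr (div_ne_zero (fun h0 ↦ hz ?_) (pow_ne_zero _ (hQ0 z z.2)))
      simp only [wronskian, eval_sub, eval_mul] at h0 ⊢
      linear_combination -h0
  · refine (hfin.preimage (f := fun xy : puncturedPlane a × puncturedPlane a ↦
      ((xy.1 : ℂ), (xy.2 : ℂ)))
      (Subtype.val_injective.prodMap Subtype.val_injective).injOn).subset ?_
    rintro ⟨x, y⟩ ⟨hne, hxy : ψ x = ψ y⟩
    refine ⟨fun h ↦ hne (Subtype.ext h), ?_, ?_⟩
    · have := hψ2 x
      rw [hxy, hψ2, div_eq_div_iff (hQ0 y y.2) (hQ0 x x.2)] at this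
      linear_combination -this
    · have := hψ1 x
      rw [hxy, hψ1, div_eq_div_iff (hq0 y y.2) (hq0 x x.2)] at this
      linear_combination -this
  · refine IsCoprime.prod_right fun j hj ↦ ?_
    refine ((irreducible_X_sub_C (a j)).coprime_iff_not_dvd.2 ?_).symm
    rw [dvd_iff_isRoot]
    refine hpq _ ?_
    simp only [hq, eval_prod]
    exact Finset.prod_eq_zero hj (by simp)

theorem theoremt (n : ℕ) (a : Fin n → ℂ) (ha : Function.Injective a) :
    -- the null homotopy class
    (∀ h : C(puncturedPlane a, ℂ × ℂˣ), h.Nullhomotopic →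
      ∀ c : puncturedPlane a, ∃ ψ : C(puncturedPlane a, ℂ × ℂˣ),
        h.Homotopic ψ ∧ IsProperMap ψ ∧ IsHolomorphicImmersion ψ ∧
        (identifiedPairs ψ).Countable ∧
        ∀ z : puncturedPlane a,
          (ψ z).1 = ((z : ℂ) - c) ^ (n + 1) / ∏ j, ((z : ℂ) - a j) ∧
          ((ψ z).2 : ℂ) = Complex.exp z) ∧
    -- the non-null homotopy classes
    (∀ h : C(puncturedPlane a, ℂ × ℂˣ), ¬ h.Nullhomotopic →
      ∃ ψ : C(puncturedPlane a, ℂ × ℂˣ),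
        h.Homotopic ψ ∧ IsProperMap ψ ∧ IsHolomorphicImmersion ψ ∧
        (identifiedPairs ψ).Finite ∧
        ∃ (k : Fin n → ℤ) (p q : ℂ[X]),
          q = ∏ j with k j = 0, (X - C (a j)) ∧ q.degree < p.degree ∧ IsCoprime p q ∧
          ∀ z : puncturedPlane a,
            (ψ z).1 = p.eval (z : ℂ) / q.eval (z : ℂ) ∧
            ((ψ z).2 : ℂ) = ∏ j, ((z : ℂ) - a j) ^ k j) := by
  exact ⟨fun _ hh c ↦ exists_properImmersion_of_nullhomotopic hh c,
    fun _ hh ↦ exists_properImmersion_of_not_nullhomotopic ha hh⟩
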